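/- **Setting.** Consider $N$ qubits on a line. A *$d$-local observable* is a Hermitian operator $A$ with $\|A\|\le 1$ that acts on at most $d$ consecutive qubits. A subspace $\mathcal C\subset(\mathbb C^2)^{\otimes N}$ is an $[[N,k,d,\varepsilon]]$ *approximate quantum error-correcting code* (AQECC) if $\dim\mathcal C=2^k$ and, for every quantum channel $\Lambda$ acting on at most $d$ consecutive qubits, $$\min_{|\psi\rangle}\max_{\mathcal D}\ \langle\psi|(\mathcal D\circ\Lambda\otimes I)(|\psi\rangle\langle\psi|)|\psi\rangle\ \ge\ 1-\varepsilon ,$$ where $|\psi\rangle$ runs over the pure joint states of $\mathcal C$ and a $2^k$-dimensional reference, and $\mathcal D$ over all decoding channels. Let $(\Omega,\mu)$ be a probability space, let $H$ be a (random) Hamiltonian on the $N$ qubits, and let $E\in\mathbb R$, $\Delta\in\mathbb R$, $\beta>0$, $c>0$. Let $S=S(E)$ be the logarithm of the number of eigenvalues of $H$ in $[E-\Delta,E+\Delta]$, counted with multiplicity. Let $|E_1\rangle,\dots,|E_{2^k}\rangle$ be (random) orthonormal eigenstates of $H$ with energies $E_i\in[E-\Delta,E+\Delta]$, and let $\mathcal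 C$ be their span. Assume, almost surely where randomness is involved: 1. (ETH) For every $d$-local observable $A$ there are smooth functions $\mathcal A$ and $f$, and random variables $R_{ij}$ with mean zero and unit variance (for example, but not necessarily, of Gaussian type), with $$\langle E_i|A|E_j\rangle=\mathcal A(E)\,\delta_{ij}+e^{-S/2}f(E,E_i-E_j)\,R_{ij},\qquad |f(E,\omega)|\le c\,e^{-\beta|\omega|/4}\ \text{ for all }\omega .$$ 2. (Narrow shell, extensive entropy) $2\beta\Delta+2\ln N\le S$. 3. (Saturated chaos bound) $\lambda=2\pi/\beta$, where $\lambda$ is the growth rate of the out-of-time-order correlator in the regime $t_d\ll t\ll t_s$. That is, there are times $t_d,t_s$, a ratio $M>1$ with $M^2t_d<t_s$, a tolerance $\eta\in(0,1)$ and a $d$-local observable $A_0$ such that the following holds. Put $\rho=e^{-\beta H}/\mathrm{Tr}\,e^{-\beta H}$, $A=A_0-\mathrm{Tr}(\rho A_0)$, $A(t)=e^{iHt}Ae^{-iHt}$, $F_2(t)=\mathrm{Tr}[\rho^{1/2}A(t)\rho^{1/2}A]$ and $F(t)=\mathrm{Tr}[(\rho^{1/4}A(t)\rho^{1/4}A)^2]$.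 Then for some $F_0>0$ and all $t$ with $Mt_d\le t\le t_s/M$, $$|F_2(t)|\le\eta\,|F_2(0)|,\qquad \bigl|F(t)-F_0\bigl(1-e^{\lambda(t-t_s)}\bigr)\bigr|\le\eta\,F_0\,e^{\lambda(t-t_s)} .$$ **Theorem (chaos–AQEC tradeoff from ETH).** For every $c>0$ there is a constant $K>0$, depending only on $c$, such that in the above setting, for every $\delta\in(0,1)$, with probability at least $1-\delta$ the following holds for every energy difference $\omega=E_i-E_j$ in the code: $\mathcal C$ is an $[[N,k,d,\varepsilon_{\mathrm{code}}]]$ AQECC with $$\varepsilon_{\mathrm{code}}=\frac{K}{\sqrt\delta}\;2^{d+2k}\exp\Bigl(-\frac S4-\frac{\pi}{2\lambda}|\omega|\Bigr).$$ -/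

import Mathlib

open scoped Matrix Kronecker

noncomputable section

namespace ETHCode

/-- Computational basis labels of a chain of `N` qubits. -/
abbrev Conf (N : ℕ) : Type := Fin N → Fin 2

/-- Operators on the `2 ^ N`-dimensional Hilbert space of `N` qubits. -/
abbrev Op (N : ℕ) : Type := Matrix (Conf N) (Conf N) ℂ

/-- Vectors of the Hilbert space of `N` qubits; the inner product is `star u ⬝ᵥ v`. -/
abbrev Ket (N : ℕ) : Type := Conf N → ℂ

/-! ### Locality -/

/-- The (at most) `d` consecutive qubits `a, a + 1, …, a + d - 1` of the chain. -/
def window (N a d : ℕ) : Finset (Fin N) :=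
  Finset.univ.filter fun i => a ≤ i.val ∧ i.val < a + d

/-- `A` acts only on the qubits in `W`: it is `B ⊗ 1` for an operator `B` on those qubits. -/
def ActsOn {N : ℕ} (W : Finset (Fin N)) (A : Op N) : Prop :=
  ∃ B : Matrix (W → Fin 2) (W → Fin 2) ℂ, ∀ x y : Conf N,
    ((∀ i, i ∉ W → x i = y i) → A x y = B (fun i => x i) (fun i => y i)) ∧
    (¬ (∀ i, i ∉ W → x i = y i) → A x y = 0)

open scoped Matrix.Norms.L2Operator in
/-- A `d`-local observable, normalized to operator norm at most one. -/
structure IsLocalObservable {N : ℕ} (d : ℕ) (A : Op N) : Prop where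
  hermitian : A.IsHermitian
  isLocal : ∃ a, ActsOn (window N a d) A
  norm_le : ‖A‖ ≤ 1

/-! ### Channels and approximate quantum error-correcting codes -/

/-- The Kraus operators of a quantum channel. -/
def IsKraus {N m : ℕ} (K : Fin m → Op N) : Prop :=
  ∑ a, (K a)ᴴ * K a = 1

/-- The channel with Kraus operators `K`, tensored with the identity of a reference system `R`. -/
def applyKraus {N m : ℕ} {R : Type} [Fintype R] [DecidableEq R] (K : Fin m → Op N)
    (ρ : Matrix (Conf N × R) (Conf N × R) ℂ) : Matrix (Conf N × R) (Conf N × R) ℂ :=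
  ∑ a, (K a ⊗ₖ (1 : Matrix R R ℂ)) * ρ * (K a ⊗ₖ (1 : Matrix R R ℂ))ᴴ

/-- `⟨ψ| (𝒟 ∘ Λ ⊗ I)(|ψ⟩⟨ψ|) |ψ⟩`, where `E`, `D` are Kraus operators of the noise `Λ` and of the
decoder `𝒟`. -/
def recoveryFidelity {N m n : ℕ} {R : Type} [Fintype R] [DecidableEq R] (E : Fin m → Op N)
    (D : Fin n → Op N) (ψ : Conf N × R → ℂ) : ℝ :=
  (star ψ ⬝ᵥ (applyKraus D (applyKraus E (Matrix.vecMulVec ψ (star ψ))) *ᵥ ψ)).re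

/-- `C` is an `[[N, k, d, ε]]` approximate quantum error-correcting code: it has dimension `2 ^ k`,
and for every channel on at most `d` consecutive qubits and every pure joint state of `C` and a
reference of dimension `2 ^ k` some decoding channel has fidelity at least `1 - ε`. -/
structure IsAQECC {N : ℕ} (k d : ℕ) (ε : ℝ) (C : Submodule ℂ (Ket N)) : Prop where
  finrank_eq : Module.finrank ℂ C = 2 ^ k
  correctable : ∀ (a m : ℕ) (E : Fin m → Op N), IsKraus E →
    (∀ l, ActsOn (window N a d) (E l)) →
    ∀ ψ : Conf N × Fin (2 ^ k) → ℂ, (∀ r, (fun q => ψ (q, r)) ∈ C) → star ψ ⬝ᵥ ψ = 1 →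
    ∃ (n : ℕ) (D : Fin n → Op N), IsKraus D ∧ 1 - ε ≤ recoveryFidelity E D ψ

/-! ### Thermal correlators and the growth rate -/

/-- The power `ρ ^ p` of the thermal state `ρ = exp (-β H) / Tr exp (-β H)`. -/
def thermalPow {N : ℕ} (H : Op N) (β p : ℝ) : Op N :=
  (((NormedSpace.exp (-(β : ℂ) • H)).trace.re ^ (-p) : ℝ) : ℂ) •
    NormedSpace.exp (-((p * β : ℝ) : ℂ) • H)

/-- The Heisenberg operator `A(t) = exp (i H t) A exp (-i H t)`. -/
def heisenberg {N : ℕ} (H A : Op N) (t : ℝ) : Op N :=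
  NormedSpace.exp ((Complex.I * (t : ℂ)) • H) * A * NormedSpace.exp (-(Complex.I * (t : ℂ)) • H)

/-- `A - Tr (ρ A)`. -/
def centred {N : ℕ} (H A : Op N) (β : ℝ) : Op N :=
  A - (thermalPow H β 1 * A).trace • (1 : Op N)

/-- `Tr [ρ^(1/2) A(t) ρ^(1/2) A]`. -/
def twoPoint {N : ℕ} (H A : Op N) (β t : ℝ) : ℂ :=
  (thermalPow H β (1 / 2) * heisenberg H A t * thermalPow H β (1 / 2) * A).trace

/-- `Tr [ρ^(1/4) A(t) ρ^(1/4) A ρ^(1/4) A(t) ρ^(1/4) A]`. -/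
def otoc {N : ℕ} (H A : Op N) (β t : ℝ) : ℂ :=
  (thermalPow H β (1 / 4) * heisenberg H A t * thermalPow H β (1 / 4) * A *
    thermalPow H β (1 / 4) * heisenberg H A t * thermalPow H β (1 / 4) * A).trace

/-- `lam` is the growth rate of the out-of-time-order correlator of the centred observable `A` in
the regime `td ≪ t ≪ ts`. Here `≪` means smaller by a factor `M > 1`; in that regime the two-point
function has decayed to a fraction `η` of its initial value, and the correlator is proportional to
`1 - exp (lam (t - ts))` up to a relative error `η < 1` of the growing term. (For a finite system
the correlator is a finite sum of oscillating exponentials, so an exact equality cannot hold.) -/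
structure HasGrowthRate {N : ℕ} (H A : Op N) (β lam td ts M η : ℝ) : Prop where
  td_pos : 0 < td
  one_lt : 1 < M
  separated : M ^ 2 * td < ts
  tol_pos : 0 < η
  tol_lt_one : η < 1
  dissipation : ∀ t, M * td ≤ t → M * t ≤ ts →
    ‖twoPoint H (centred H A β) β t‖ ≤ η * ‖twoPoint H (centred H A β) β 0‖
  growth : ∃ F₀ : ℝ, 0 < F₀ ∧ ∀ t, M * td ≤ t → M * t ≤ ts →
    ‖otoc H (centred H A β) β t - ((F₀ * (1 - Real.exp (lam * (t - ts))) : ℝ) : ℂ)‖ ≤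
      η * (F₀ * Real.exp (lam * (t - ts)))

/-! ### The microcanonical shell and the eigenstate thermalization ansatz -/

/-- The span of all eigenvectors of `H` with energy in `[E - Δ, E + Δ]`. -/
def shell {N : ℕ} (H : Op N) (E Δ : ℝ) : Submodule ℂ (Ket N) :=
  ⨆ e ∈ Set.Icc (E - Δ) (E + Δ), Module.End.eigenspace (Matrix.toLin' H) (e : ℂ)

/-- Microcanonical entropy: the logarithm of the number of energy levels in the shell, counted with
multiplicity. -/
def microEntropy {N : ℕ} (H : Op N) (E Δ : ℝ) : ℝ :=
  Real.log (Module.finrank ℂ (shell H E Δ))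

/-- `ψ` is an orthonormal family of eigenstates of `H`, with energies `e` in `[E - Δ, E + Δ]`. -/
structure IsShellFamily {N : ℕ} {ι : Type} [DecidableEq ι] (H : Op N) (E Δ : ℝ) (e : ι → ℝ)
    (ψ : ι → Ket N) : Prop where
  orthonormal : ∀ i j, star (ψ i) ⬝ᵥ ψ j = if i = j then 1 else 0
  eigen : ∀ i, H *ᵥ ψ i = (e i : ℂ) • ψ i
  mem_shell : ∀ i, e i ∈ Set.Icc (E - Δ) (E + Δ)

/-- The eigenstate thermalization ansatz at energy `E` for the observable `A`, in the random states
`ψ x i` with energies `e x i` and entropy `S x`: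
`⟨E_i| A |E_j⟩ = 𝒜(E) δ_ij + exp (-S / 2) f(E, E_i - E_j) R_ij`,
with smooth `𝒜` and `f`, an envelope `|f(E, ω)| ≤ c exp (-β |ω| / 4)`, and random variables `R_ij`
of mean zero and unit variance. Their law is not restricted further, so this contains the Gaussian
case; exactly Gaussian matrix elements of a bounded operator would be unbounded, hence impossible
unless `f` vanishes. No independence is assumed. -/
def SatisfiesETH {N : ℕ} {ι Ω : Type*} [DecidableEq ι] [MeasurableSpace Ω]
    (μ : MeasureTheory.Measure Ω) (β c E : ℝ) (S : Ω → ℝ) (e : Ω → ι → ℝ) (ψ : Ω → ι → Ket N)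
    (A : Op N) : Prop :=
  ∃ (avg : ℝ → ℝ) (f : ℝ → ℝ → ℝ) (R : ι → ι → Ω → ℂ),
    ContDiff ℝ (⊤ : ℕ∞) avg ∧
    ContDiff ℝ (⊤ : ℕ∞) (fun p : ℝ × ℝ => f p.1 p.2) ∧
    (∀ ω, |f E ω| ≤ c * Real.exp (-(β / 4) * |ω|)) ∧
    (∀ i j, MeasureTheory.MemLp (R i j) 2 μ ∧ ∫ x, R i j x ∂μ = 0 ∧ ∫ x, ‖R i j x‖ ^ 2 ∂μ = 1) ∧
    ∀ᵐ x ∂μ, ∀ i j, star (ψ x i) ⬝ᵥ (A *ᵥ ψ x j) =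
      (if i = j then (avg E : ℂ) else 0) +
        ((Real.exp (-S x / 2) * f E (e x i - e x j) : ℝ) : ℂ) * R i j x

end ETHCode

end

/-!
By the eigenstate thermalization ansatz, the matrix of every local observable in the code states is
a scalar up to random entries of size `c e^(-S/2)` with unit second moment. Expanding a local
operator in the `4 ^ d` Weyl operators of its window, the Cauchy–Schwarz inequality bounds the
error of all local contractions by one random variable with mean of order `N 4 ^ d 4 ^ k`. By
Markov's inequality, with probability at least `1 - δ` the Knill–Laflamme condition therefore holds
up to an error `κ ~ c e^(-S/2) √N 2 ^ (d + k) / √δ`, simultaneously for all local operators.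

For such a code the joint state of reference and environment is close in trace norm to a product
state. By Uhlmann's argument a decoder then exists: an isometry carries the purification of the
noisy state to that of the product state, and the overlap of the two is bounded by the
Powers–Størmer inequality `‖√ρ - √σ‖₂² ≤ ‖ρ - σ‖₁`. This costs another factor `2 ^ k`. Finally
`β |ω| + 2 log N ≤ S` turns `e^(-S/2) √N` into `e^(-S/4 - β |ω| / 4)`, and `β / 4 = π / (2 λ)`.
-/

noncomputable section

namespace ETHCode

open Matrix
open scoped Matrix.Norms.L2Operator

section Matrix

variable {𝕜 m n p q : Type*} [RCLike 𝕜] [Fintype m] [Fintype n]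

theorem trace_conjTranspose_mul (A B : Matrix m n 𝕜) :
    (Aᴴ * B).trace = ∑ x, ∑ y, star (A x y) * B x y := by
  rw [Finset.sum_comm]; rfl

theorem trace_conjTranspose_mul_self (A : Matrix m n 𝕜) :
    (Aᴴ * A).trace = ((∑ x, ∑ y, ‖A x y‖ ^ 2 : ℝ) : 𝕜) := by
  rw [trace_conjTranspose_mul]
  push_cast
  exact Finset.sum_congr rfl fun x _ => Finset.sum_congr rfl fun y _ => RCLike.conj_mul _

theorem norm_trace_conjTranspose_mul_sq_le (A B : Matrix m n 𝕜) :
    ‖(Aᴴ * B).trace‖ ^ 2 ≤ (∑ x, ∑ y, ‖A x y‖ ^ 2) * ∑ x, ∑ y, ‖B x y‖ ^ 2 := by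
  simp_rw [trace_conjTranspose_mul, ← Fintype.sum_prod_type']
  calc ‖∑ u : m × n, star (A u.1 u.2) * B u.1 u.2‖ ^ 2
      ≤ (∑ u : m × n, ‖A u.1 u.2‖ * ‖B u.1 u.2‖) ^ 2 := by
        gcongr
        exact norm_sum_le_of_le _ fun u _ => by rw [norm_mul, norm_star]
    _ ≤ _ := Finset.sum_mul_sq_le_sq_mul_sq _ _ _

variable [DecidableEq n]

theorem sum_norm_sq_col_le_l2_opNorm_sq (A : Matrix m n 𝕜) (j : n) :
    ∑ i, ‖A i j‖ ^ 2 ≤ ‖A‖ ^ 2 := by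
  have h := A.l2_opNorm_mulVec (EuclideanSpace.single j 1)
  rw [PiLp.norm_single, norm_one, mul_one] at h
  simpa [EuclideanSpace.norm_sq_eq] using pow_le_pow_left₀ (norm_nonneg _) h 2

theorem l2_opNorm_one_le : ‖(1 : Matrix n n 𝕜)‖ ≤ 1 := by
  rw [← diagonal_one, l2_opNorm_diagonal]
  exact (pi_norm_const_le (1 : 𝕜)).trans_eq norm_one

theorem l2_opNorm_le_one_of_conjTranspose_mul_self_eq_one {U : Matrix m n 𝕜} (h : Uᴴ * U = 1) :
    ‖U‖ ≤ 1 := by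
  classical
  rw [← sq_le_one_iff₀ (norm_nonneg U), sq, ← l2_opNorm_conjTranspose_mul_self, h]
  exact l2_opNorm_one_le

theorem conjTranspose_mul_mul_mul_cancel {U : Matrix m n 𝕜} (h : Uᴴ * U = 1)
    (A : Matrix n p 𝕜) (B : Matrix n q 𝕜) : (U * A)ᴴ * (U * B) = Aᴴ * B := by
  rw [conjTranspose_mul, Matrix.mul_assoc, ← Matrix.mul_assoc Uᴴ, h, Matrix.one_mul]

theorem card_le_of_conjTranspose_mul_self_eq_one {U : Matrix m n 𝕜} (h : Uᴴ * U = 1) :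
    Fintype.card n ≤ Fintype.card m :=
  calc Fintype.card n = (Uᴴ * U).rank := by rw [h, rank_one]
    _ ≤ U.rank := rank_mul_le_right _ _
    _ ≤ Fintype.card m := rank_le_card_height U

end Matrix

section Isometry

variable {𝕜 X Y Z : Type*} [RCLike 𝕜] [AddCommGroup X] [Module 𝕜 X]
  [NormedAddCommGroup Y] [InnerProductSpace 𝕜 Y] [FiniteDimensional 𝕜 Y]
  [NormedAddCommGroup Z] [InnerProductSpace 𝕜 Z] [FiniteDimensional 𝕜 Z]

theorem nonempty_linearIsometry_of_finrank_le
    (h : Module.finrank 𝕜 Y ≤ Module.finrank 𝕜 Z) : Nonempty (Y →ₗᵢ[𝕜] Z) := by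
  let bY := stdOrthonormalBasis 𝕜 Y
  let bZ := stdOrthonormalBasis 𝕜 Z
  refine ⟨(bY.toBasis.constr 𝕜 (bZ ∘ Fin.castLE h)).isometryOfOrthonormal
    (v := bY.toBasis) (by simp) ?_⟩
  convert bZ.orthonormal.comp _ (Fin.castLE_injective h) using 1
  ext i
  simp

theorem exists_linearIsometry_comp_eq (h : Module.finrank 𝕜 Y ≤ Module.finrank 𝕜 Z)
    (a : X →ₗ[𝕜] Y) (b : X →ₗ[𝕜] Z) (hab : ∀ x, ‖a x‖ = ‖b x‖) :
    ∃ L : Y →ₗᵢ[𝕜] Z, ∀ x, L (a x) = b x := by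
  obtain ⟨j⟩ := nonempty_linearIsometry_of_finrank_le h
  let a' : X →ₗ[𝕜] Z := j.toLinearMap ∘ₗ a
  have ha' (x : X) : ‖a' x‖ = ‖b x‖ := (j.norm_map _).trans (hab x)
  obtain ⟨g, hg⟩ := a'.rangeRestrict.exists_rightInverse_of_surjective a'.range_rangeRestrict
  have hag (y : LinearMap.range a') : a' (g y) = y :=
    congrArg Subtype.val (LinearMap.congr_fun hg y)
  let U : LinearMap.range a' →ₗᵢ[𝕜] Z :=
    ⟨b ∘ₗ g, fun y => by rw [LinearMap.comp_apply, ← ha', hag, Submodule.coe_norm]⟩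
  refine ⟨U.extend.comp j, fun x => ?_⟩
  have hU : U.extend (a' x) = b (g ⟨a' x, x, rfl⟩) := U.extend_apply ⟨a' x, x, rfl⟩
  refine hU.trans (sub_eq_zero.mp (norm_eq_zero.mp ?_))
  rw [← map_sub, ← ha', map_sub, hag, sub_self, norm_zero]

variable {m n p : Type*} [Fintype m]

theorem norm_toEuclideanLin_sq [Fintype n] [DecidableEq n] (A : Matrix m n 𝕜)
    (x : EuclideanSpace 𝕜 n) :
    ((‖toEuclideanLin A x‖ : 𝕜)) ^ 2 = star x.ofLp ⬝ᵥ ((Aᴴ * A) *ᵥ x.ofLp) := by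
  rw [← inner_self_eq_norm_sq_to_K, EuclideanSpace.inner_eq_star_dotProduct, ← mulVec_mulVec,
    dotProduct_mulVec, ← star_mulVec, dotProduct_comm]
  rfl

theorem exists_isometry_mul_eq [Finite n] [Fintype p] [DecidableEq m]
    (hcard : Fintype.card m ≤ Fintype.card p) (A : Matrix m n 𝕜) (B : Matrix p n 𝕜)
    (h : Aᴴ * A = Bᴴ * B) : ∃ W : Matrix p m 𝕜, Wᴴ * W = 1 ∧ W * A = B := by
  classical
  cases nonempty_fintype n
  obtain ⟨L, hL⟩ := exists_linearIsometry_comp_eq (𝕜 := 𝕜)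
    (by simpa using hcard) (toEuclideanLin A) (toEuclideanLin B) fun x => by
      rw [← pow_left_inj₀ (norm_nonneg _) (norm_nonneg _) two_ne_zero]
      exact_mod_cast (norm_toEuclideanLin_sq A x).trans (h ▸ (norm_toEuclideanLin_sq B x).symm)
  refine ⟨toEuclideanLin.symm L.toLinearMap, ?_, ?_⟩
  · apply toEuclideanLin.injective
    rw [toLpLin_mul_same, toEuclideanLin_conjTranspose_eq_adjoint, LinearEquiv.apply_symm_apply]
    ext1 x
    refine ext_inner_left 𝕜 fun y => ?_
    simp
  · apply toEuclideanLin.injective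
    ext1 x
    rw [toLpLin_mul_same, LinearEquiv.apply_symm_apply]
    exact hL x

end Isometry

section PosSemidef

open scoped MatrixOrder ComplexOrder

variable {𝕜 m n p : Type*} [RCLike 𝕜] [Fintype m] [Fintype n] [Fintype p]

theorem trace_mul_nonneg {A B : Matrix n n 𝕜} (hA : 0 ≤ A) (hB : 0 ≤ B) :
    0 ≤ (A * B).trace := by
  classical
  have h := (hB.posSemidef.conjTranspose_mul_mul_same (CFC.sqrt A)).trace_nonneg
  rwa [(CFC.sqrt_nonneg A).posSemidef.1.eq, trace_mul_cycle, CFC.sqrt_mul_sqrt_self A hA] at h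

variable [DecidableEq n]

theorem exists_unitary_commute_le_mul {D : Matrix n n 𝕜} (hD : D.IsHermitian) :
    ∃ S : Matrix n n 𝕜, Sᴴ * S = 1 ∧ Commute S D ∧ D ≤ S * D ∧ -D ≤ S * D := by
  let sign : ℝ → ℝ := fun x => if 0 ≤ x then 1 else -1
  have hc (f : ℝ → ℝ) : ContinuousOn f (spectrum ℝ D) :=
    (finite_real_spectrum (A := D)).continuousOn f
  have hid : cfc (fun x : ℝ => x) D = D := cfc_id' ℝ D hD
  have habs : cfc sign D * D = cfc (fun x : ℝ => |x|) D := calc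
    cfc sign D * D = cfc sign D * cfc (fun x : ℝ => x) D := by rw [hid]
    _ = cfc (fun x => sign x * x) D := (cfc_mul _ _ D (hc _) (hc _)).symm
    _ = cfc (fun x : ℝ => |x|) D := by
      congr with x
      rcases le_or_gt 0 x with hx | hx
      · simp [sign, hx, abs_of_nonneg]
      · simp [sign, hx.not_ge, abs_of_neg hx]
  refine ⟨cfc sign D, ?_, ?_, ?_, ?_⟩
  · rw [← star_eq_conjTranspose, ← cfc_star, ← cfc_mul _ _ D (hc _) (hc _)]
    refine (cfc_congr fun x _ => ?_).trans (cfc_const_one ℝ D hD)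
    by_cases hx : 0 ≤ x <;> simp [sign, hx]
  · simpa only [hid] using cfc_commute_cfc sign (fun x => x) D
  · calc D = cfc (fun x : ℝ => x) D := hid.symm
      _ ≤ cfc (fun x : ℝ => |x|) D := cfc_mono (fun x _ => le_abs_self x) (hc _) (hc _)
      _ = cfc sign D * D := habs.symm
  · calc -D = cfc (fun x : ℝ => -x) D := (cfc_neg_id D).symm
      _ ≤ cfc (fun x : ℝ => |x|) D := cfc_mono (fun x _ => neg_le_abs x) (hc _) (hc _)
      _ = cfc sign D * D := habs.symm

/-- The Powers–Størmer inequality, with the trace norm attained at the sign of `A - B`. -/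
theorem exists_unitary_trace_sub_sq_le {A B : Matrix n n 𝕜} (hA : 0 ≤ A) (hB : 0 ≤ B) :
    ∃ S : Matrix n n 𝕜, Sᴴ * S = 1 ∧
      ((A - B) * (A - B)).trace ≤ ((A * A - B * B) * S).trace := by
  obtain ⟨D, hD⟩ : ∃ D, D = A - B := ⟨_, rfl⟩
  obtain ⟨S, hS, hcomm, hle, hneg_le⟩ :=
    exists_unitary_commute_le_mul (hD ▸ hA.posSemidef.1.sub hB.posSemidef.1)
  have hA_part : 0 ≤ (A * (S * D - D)).trace := trace_mul_nonneg hA (sub_nonneg.mpr hle)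
  have hB_part : 0 ≤ (B * (S * D + D)).trace :=
    trace_mul_nonneg hB (neg_le_iff_add_nonneg.mp hneg_le)
  have hsplit : (A * A - B * B) * S = A * (D * S) + D * B * S := by rw [hD]; noncomm_ring
  refine ⟨S, hS, sub_nonneg.mp ?_⟩
  calc 0 ≤ (A * (S * D - D)).trace + (B * (S * D + D)).trace := add_nonneg hA_part hB_part
    _ = (A * (D * S)).trace + (D * B * S).trace - (A * D - B * D).trace := by
      rw [mul_sub, trace_sub, mul_add, trace_add, ← mul_assoc B, trace_mul_cycle B, hcomm.eq,
        trace_sub]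
      ring
    _ = ((A * A - B * B) * S).trace - ((A - B) * (A - B)).trace := by
      rw [hsplit, trace_add, ← sub_mul, hD]

/-- Uhlmann's theorem, with the fidelity bounded by the Powers–Størmer inequality. -/
theorem exists_isometry_overlap_ge [DecidableEq m]
    (hmp : Fintype.card m ≤ Fintype.card p) (hnp : Fintype.card n ≤ Fintype.card p)
    {A : Matrix m n ℂ} {B : Matrix p n ℂ} (hA : (Aᴴ * A).trace = 1) (hB : (Bᴴ * B).trace = 1)
    {r : ℝ} (hr : ∀ S : Matrix n n ℂ, Sᴴ * S = 1 → ‖((Aᴴ * A - Bᴴ * B) * S).trace‖ ≤ r) :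
    ∃ W : Matrix p m ℂ, Wᴴ * W = 1 ∧ 1 - r / 2 ≤ (Bᴴ * (W * A)).trace.re := by
  set a := CFC.sqrt (Aᴴ * A)
  set b := CFC.sqrt (Bᴴ * B)
  have hap : 0 ≤ a := CFC.sqrt_nonneg _
  have hbp : 0 ≤ b := CFC.sqrt_nonneg _
  have haa : a * a = Aᴴ * A := CFC.sqrt_mul_sqrt_self _ (posSemidef_conjTranspose_mul_self A).nonneg
  have hbb : b * b = Bᴴ * B := CFC.sqrt_mul_sqrt_self _ (posSemidef_conjTranspose_mul_self B).nonneg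
  obtain ⟨U, hU, hUb⟩ := exists_isometry_mul_eq hnp b B (by rw [hbp.posSemidef.1, hbb])
  obtain ⟨W, hW, hWA⟩ := exists_isometry_mul_eq hmp A (U * a) <| by
    rw [conjTranspose_mul_mul_mul_cancel hU, hap.posSemidef.1, haa]
  have hoverlap : Bᴴ * (W * A) = b * a := by
    rw [hWA, ← hUb, conjTranspose_mul_mul_mul_cancel hU, hbp.posSemidef.1]
  have htrace : ((a - b) * (a - b)).trace = 2 - 2 * (b * a).trace := by
    rw [sub_mul, mul_sub, mul_sub, haa, hbb, trace_sub, trace_sub, trace_sub, hA, hB,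
      trace_mul_comm a b]
    ring
  obtain ⟨S, hS, hle⟩ := exists_unitary_trace_sub_sq_le hap hbp
  have hdist : 2 - 2 * (b * a).trace.re ≤ r := calc
    2 - 2 * (b * a).trace.re = ((a - b) * (a - b)).trace.re := by simp [htrace]
    _ ≤ ((a * a - b * b) * S).trace.re := (Complex.le_def.mp hle).1
    _ ≤ ‖((a * a - b * b) * S).trace‖ := Complex.re_le_norm _
    _ ≤ r := by rw [haa, hbb]; exact hr S hS
  exact ⟨W, hW, by rw [hoverlap]; linarith⟩

end PosSemidef

section Weyl

theorem exists_eq_sum_smul_of_trace_orthogonal {ι G : Type*} [Fintype ι] [Fintype G]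
    [DecidableEq ι] [Nonempty G] {U : ι → Matrix G G ℂ}
    (hU : ∀ v w, ((U v)ᴴ * U w).trace = if v = w then (Fintype.card G : ℂ) else 0)
    (hcard : Fintype.card ι = Fintype.card G * Fintype.card G) (B : Matrix G G ℂ) :
    ∃ o : ι → ℂ, B = ∑ w, o w • U w ∧
      ∑ w, ‖o w‖ ^ 2 = (Fintype.card G : ℝ)⁻¹ * ∑ x, ∑ y, ‖B x y‖ ^ 2 := by
  set r : ℝ := (√(Fintype.card G))⁻¹ with hr
  have hr_sq : r ^ 2 = (Fintype.card G : ℝ)⁻¹ := by rw [hr, inv_pow, Real.sq_sqrt (by positivity)]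
  let vec : Matrix G G ℂ → EuclideanSpace ℂ (G × G) := fun M => WithLp.toLp 2 fun p => M p.1 p.2
  have hinner (M M' : Matrix G G ℂ) : inner ℂ (vec M) (vec M') = (Mᴴ * M').trace := by
    rw [trace_conjTranspose_mul, EuclideanSpace.inner_eq_star_dotProduct, dotProduct,
      Fintype.sum_prod_type]
    exact Finset.sum_congr rfl fun x _ => Finset.sum_congr rfl fun y _ => mul_comm _ _
  have horth : Orthonormal ℂ fun w => (r : ℂ) • vec (U w) := by
    rw [orthonormal_iff_ite]
    intro v w
    rw [inner_smul_left, inner_smul_right, hinner, hU, Complex.conj_ofReal, ← mul_assoc, ← sq,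
      ← Complex.ofReal_pow, hr_sq]
    split_ifs <;> simp
  let b : OrthonormalBasis ι ℂ (EuclideanSpace ℂ (G × G)) := OrthonormalBasis.mk horth <|
    (horth.linearIndependent.span_eq_top_of_card_eq_finrank' (by simp [hcard])).ge
  refine ⟨fun w => inner ℂ (b w) (vec B) * r, ?_, ?_⟩
  · ext x y
    have h := congrArg (fun v => v.ofLp (x, y)) (b.sum_repr' (vec B))
    simpa [b, vec, Matrix.sum_apply, inner_smul_left, mul_left_comm, mul_assoc,
      -Complex.coe_smul] using h.symm
  · simp_rw [norm_mul, mul_pow, ← Finset.sum_mul, b.sum_sq_norm_inner_right, Complex.norm_real,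
      Real.norm_eq_abs, sq_abs, hr_sq, EuclideanSpace.norm_sq_eq, Fintype.sum_prod_type,
      mul_comm (_ : ℝ)⁻¹]
    rfl

variable {G : Type*} [AddCommGroup G] [Fintype G] [DecidableEq G]

/-- The Weyl (generalized Pauli) operator of a finite abelian group: translation by `w.1` combined
with multiplication by the character `w.2`. For `(ℤ/2)^n` these are the Pauli strings up to
phase. -/
def weyl (w : G × AddChar G ℂ) : Matrix G G ℂ :=
  of fun x y => if y = x + w.1 then w.2 x else 0

theorem conjTranspose_weyl_mul_self (w : G × AddChar G ℂ) : (weyl w)ᴴ * weyl w = 1 := by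
  rw [mul_eq_one_comm]
  ext x y
  rw [mul_apply, one_apply]
  rcases eq_or_ne x y with rfl | h
  · simp [weyl, apply_ite, Complex.mul_conj', AddChar.norm_apply]
  · simp [weyl, h]

theorem trace_conjTranspose_weyl_mul_weyl (v w : G × AddChar G ℂ) :
    ((weyl v)ᴴ * weyl w).trace = if v = w then (Fintype.card G : ℂ) else 0 := by
  have hchar (χ η : AddChar G ℂ) :
      ∑ x, star (χ x) * η x = if χ = η then (Fintype.card G : ℂ) else 0 := by
    have h := AddChar.wInner_cWeight_eq_boole χ η
    rw [RCLike.wInner_cWeight_eq_expect, Fintype.expect_eq_sum_div_card,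
      div_eq_iff (by simp), ite_mul, one_mul, zero_mul] at h
    simpa only [RCLike.inner_apply', RCLike.star_def] using h
  have hrow (x : G) : ∑ y, star (weyl v x y) * weyl w x y =
      if v.1 = w.1 then star (v.2 x) * w.2 x else 0 := by
    simp [weyl, eq_comm, apply_ite (starRingEnd ℂ)]
  rw [trace_conjTranspose_mul]
  simp_rw [hrow, Finset.sum_ite_irrel, hchar, Finset.sum_const_zero, ← ite_and, ← Prod.ext_iff]

theorem exists_eq_sum_smul_weyl (B : Matrix G G ℂ) :
    ∃ o : G × AddChar G ℂ → ℂ, B = ∑ w, o w • weyl w ∧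
      ∑ w, ‖o w‖ ^ 2 = (Fintype.card G : ℝ)⁻¹ * ∑ x, ∑ y, ‖B x y‖ ^ 2 :=
  exists_eq_sum_smul_of_trace_orthogonal trace_conjTranspose_weyl_mul_weyl (by simp) B

end Weyl

section Local

variable {N : ℕ} {W : Finset (Fin N)}

/-- The tensor factorization of the chain into the qubits in `W` and the others. -/
def splitConf (W : Finset (Fin N)) : Conf N ≃ (W → Fin 2) × ({i // i ∉ W} → Fin 2) :=
  Equiv.piEquivPiSubtypeProd (· ∈ W) fun _ => Fin 2

/-- The operator `B ⊗ 1` on the whole chain, for an operator `B` on the qubits in `W`. -/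
def embed (W : Finset (Fin N)) : Matrix (W → Fin 2) (W → Fin 2) ℂ →⋆ₐ[ℂ] Op N where
  toFun B := (B ⊗ₖ 1).submatrix (splitConf W) (splitConf W)
  map_one' := by rw [one_kronecker_one, submatrix_one_equiv]
  map_mul' A B := by rw [submatrix_mul_equiv, ← mul_kronecker_mul, mul_one]
  map_zero' := by rw [zero_kronecker]; rfl
  map_add' A B := by rw [add_kronecker]; rfl
  commutes' c := by
    rw [Algebra.algebraMap_eq_smul_one, Algebra.algebraMap_eq_smul_one, smul_kronecker,
      one_kronecker_one, submatrix_smul, Pi.smul_apply, Pi.smul_apply, submatrix_one_equiv]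
  map_star' A := by
    simp only [star_eq_conjTranspose, conjTranspose_submatrix, conjTranspose_kronecker,
      conjTranspose_one]

/-- The algebra of operators supported on `W`, in which the Kraus operators of the noise live. -/
def localAlgebra (W : Finset (Fin N)) : StarSubalgebra ℂ (Op N) := (embed W).range

theorem embed_apply (B : Matrix (W → Fin 2) (W → Fin 2) ℂ) (x y : Conf N) :
    embed W B x y = if ∀ i ∉ W, x i = y i then B (fun i => x i) (fun i => y i) else 0 := by
  have h : (splitConf W x).2 = (splitConf W y).2 ↔ ∀ i ∉ W, x i = y i := by
    rw [funext_iff, Subtype.forall]; rfl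
  change B _ _ * (1 : Matrix _ _ ℂ) _ _ = _
  rw [one_apply, mul_ite, mul_one, mul_zero]
  exact if_congr h rfl rfl

theorem mem_localAlgebra {A : Op N} : A ∈ localAlgebra W ↔ ActsOn W A := by
  refine exists_congr fun B => ⟨?_, fun h => ?_⟩
  · rintro rfl x y
    exact ⟨fun h => (embed_apply B x y).trans (if_pos h),
      fun h => (embed_apply B x y).trans (if_neg h)⟩
  · ext x y
    change embed W B x y = A x y
    rw [embed_apply]
    split_ifs with hxy
    exacts [((h x y).1 hxy).symm, ((h x y).2 hxy).symm]

theorem norm_embed (B : Matrix (W → Fin 2) (W → Fin 2) ℂ) : ‖embed W B‖ = ‖B‖ :=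
  NonUnitalStarAlgHom.norm_map (embed W) (embed W).toRingHom.injective B

theorem exists_eq_sum_smul_embed_weyl {A : Op N} (hA : A ∈ localAlgebra W) :
    ∃ o : (W → Fin 2) × AddChar (W → Fin 2) ℂ → ℂ,
      A = ∑ w, o w • embed W (weyl w) ∧ ∑ w, ‖o w‖ ^ 2 ≤ ‖A‖ ^ 2 := by
  obtain ⟨B, rfl⟩ := hA
  obtain ⟨o, hB, ho⟩ := exists_eq_sum_smul_weyl B
  refine ⟨o, ?_, ?_⟩
  · change embed W B = _
    conv_lhs => rw [hB, map_sum]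
    simp only [map_smul]
  · change _ ≤ ‖embed W B‖ ^ 2
    rw [ho, norm_embed, Finset.sum_comm, inv_mul_le_iff₀ (by positivity)]
    simpa using Finset.sum_le_sum fun y (_ : y ∈ Finset.univ) =>
      sum_norm_sq_col_le_l2_opNorm_sq B y

theorem norm_embed_weyl_le_one (w : (W → Fin 2) × AddChar (W → Fin 2) ℂ) :
    ‖embed W (weyl w)‖ ≤ 1 :=
  (norm_embed _).trans_le <|
    l2_opNorm_le_one_of_conjTranspose_mul_self_eq_one (conjTranspose_weyl_mul_self w)

end Local

section Compression

variable {ι q : Type*} [Fintype q]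

/-- The compression `Vᴴ O V`: the matrix of `O` in the code whose encoding isometry is `V`. -/
def compression (V : Matrix q ι ℂ) : Matrix q q ℂ →ₗ[ℂ] Matrix ι ι ℂ where
  toFun O := Vᴴ * O * V
  map_add' A B := by rw [Matrix.mul_add, Matrix.add_mul]
  map_smul' c A := by rw [Matrix.mul_smul, Matrix.smul_mul, RingHom.id_apply]

theorem compression_apply (V : Matrix q ι ℂ) (O : Matrix q q ℂ) :
    compression V O = Vᴴ * O * V := rfl

end Compression

section NearScalar

variable {ι κ q : Type*} [DecidableEq ι]

/-- `C` is a scalar matrix up to entrywise error `r`. For a compression this is the approximate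
Knill–Laflamme condition. -/
def NearScalar (r : ℝ) (C : Matrix ι ι ℂ) : Prop :=
  ∃ l : ℂ, ∀ i j, ‖(C - l • (1 : Matrix ι ι ℂ)) i j‖ ≤ r

theorem NearScalar.mono {r s : ℝ} {C : Matrix ι ι ℂ} (h : NearScalar r C) (hrs : r ≤ s) :
    NearScalar s C := by
  obtain ⟨l, hl⟩ := h
  exact ⟨l, fun i j => (hl i j).trans hrs⟩

theorem NearScalar.smul {r : ℝ} {C : Matrix ι ι ℂ} (h : NearScalar r C) (c : ℂ) :
    NearScalar (‖c‖ * r) (c • C) := by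
  obtain ⟨l, hl⟩ := h
  refine ⟨c * l, fun i j => ?_⟩
  rw [mul_smul, ← smul_sub, Matrix.smul_apply, norm_smul]
  exact mul_le_mul_of_nonneg_left (hl i j) (norm_nonneg c)

theorem NearScalar.sum [Fintype κ] {r : κ → ℝ} {C : κ → Matrix ι ι ℂ}
    (h : ∀ w, NearScalar (r w) (C w)) : NearScalar (∑ w, r w) (∑ w, C w) := by
  choose l hl using h
  refine ⟨∑ w, l w, fun i j => ?_⟩
  rw [Finset.sum_smul, ← Finset.sum_sub_distrib, Matrix.sum_apply]
  exact norm_sum_le_of_le _ fun w _ => hl w i j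

theorem NearScalar.sum_smul [Fintype κ] {s b : ℝ} {z : κ → ℝ} {C : κ → Matrix ι ι ℂ} {o : κ → ℂ}
    (hs : 0 ≤ s) (hz : ∀ w, 0 ≤ z w) (ho : ∑ w, ‖o w‖ ^ 2 ≤ b)
    (h : ∀ w, NearScalar (s * √(z w)) (C w)) :
    NearScalar (s * √(b * ∑ w, z w)) (∑ w, o w • C w) := by
  refine (NearScalar.sum fun w => (h w).smul (o w)).mono ?_
  calc ∑ w, ‖o w‖ * (s * √(z w)) = s * ∑ w, ‖o w‖ * √(z w) := by
        rw [Finset.mul_sum]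
        exact Finset.sum_congr rfl fun w _ => mul_left_comm _ _ _
    _ ≤ s * (√(∑ w, ‖o w‖ ^ 2) * √(∑ w, √(z w) ^ 2)) := by
        gcongr
        exact Real.sum_mul_le_sqrt_mul_sqrt _ _ _
    _ = s * √((∑ w, ‖o w‖ ^ 2) * ∑ w, z w) := by
        rw [← Real.sqrt_mul (by positivity)]
        simp_rw [Real.sq_sqrt (hz _)]
    _ ≤ s * √(b * ∑ w, z w) := by
        have := Finset.sum_nonneg fun w (_ : w ∈ Finset.univ) => hz w
        gcongr

/-- The deviation of a matrix from a scalar. Subtracting the entry at `i₀`, rather than the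
unspecified best scalar, makes it linear and costs a factor `2`. -/
def deviation (i₀ : ι) : Matrix ι ι ℂ →ₗ[ℂ] Matrix ι ι ℂ :=
  LinearMap.id - (entryLinearMap ℂ ℂ i₀ i₀).smulRight 1

theorem deviation_apply (i₀ : ι) (C : Matrix ι ι ℂ) : deviation i₀ C = C - C i₀ i₀ • 1 := rfl

theorem NearScalar.norm_deviation_le {r : ℝ} {C : Matrix ι ι ℂ} (h : NearScalar r C)
    (i₀ i j : ι) : ‖deviation i₀ C i j‖ ≤ 2 * r := by
  obtain ⟨l, hl⟩ := h
  have hsplit : deviation i₀ C = (C - l • 1) - (C - l • 1) i₀ i₀ • (1 : Matrix ι ι ℂ) := by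
    simp [deviation_apply, sub_smul]
  have hone : ‖(1 : Matrix ι ι ℂ) i j‖ ≤ 1 := by rw [one_apply]; split_ifs <;> simp
  calc ‖deviation i₀ C i j‖
      ≤ ‖(C - l • 1) i j‖ + ‖(C - l • 1) i₀ i₀‖ * ‖(1 : Matrix ι ι ℂ) i j‖ := by
        rw [hsplit, Matrix.sub_apply _ _ i j, Matrix.smul_apply, smul_eq_mul, ← norm_mul]
        exact norm_sub_le _ _
    _ ≤ r + r * 1 := by
        have := (norm_nonneg _).trans (hl i₀ i₀)
        gcongr <;> apply hl
    _ = 2 * r := by ring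

theorem norm_deviation_compression_le [Fintype q] [DecidableEq q] {V : Matrix q ι ℂ} {κ : ℝ}
    {𝒜 : Submodule ℂ (Matrix q q ℂ)} (h : ∀ O ∈ 𝒜, ‖O‖ ≤ 1 → NearScalar κ (compression V O))
    {O : Matrix q q ℂ} (hO : O ∈ 𝒜) (i₀ i j : ι) :
    ‖deviation i₀ (compression V O) i j‖ ≤ 2 * κ * ‖O‖ := by
  rcases eq_or_ne O 0 with rfl | hO0
  · simp
  have hn : ‖O‖ ≠ 0 := norm_ne_zero_iff.mpr hO0
  have hunit := (h ((‖O‖⁻¹ : ℂ) • O) (𝒜.smul_mem _ hO) (by simp [norm_smul, hn])).smul ‖O‖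
  rw [← map_smul, smul_inv_smul₀ (by exact_mod_cast hn), Complex.norm_real, norm_norm] at hunit
  exact (hunit.norm_deviation_le i₀ i j).trans_eq (by ring)

end NearScalar

section Stack

variable {α ρ p q : Type*} [Fintype α] [Fintype ρ] [Fintype p]

/-- The block column of a family of matrices. For Kraus operators it is the Stinespring isometry,
with environment `α`. -/
def stack (F : α → Matrix p q ℂ) : Matrix (p × α) q ℂ :=
  of fun u y => F u.2 u.1 y

theorem conjTranspose_stack_mul_stack (F : α → Matrix p q ℂ) :
    (stack F)ᴴ * stack F = ∑ u, (F u)ᴴ * F u := by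
  ext x y
  rw [mul_apply, Fintype.sum_prod_type_right, Matrix.sum_apply]
  rfl

theorem conjTranspose_stack_mul_kronecker_mul_stack [DecidableEq p] (F G : α → Matrix p q ℂ)
    (S : Matrix α α ℂ) :
    (stack F)ᴴ * (((1 : Matrix p p ℂ) ⊗ₖ S) * stack G) = ∑ u, ∑ v, S u v • ((F u)ᴴ * G v) := by
  ext x y
  simp only [mul_apply, conjTranspose_apply, stack, of_apply, kroneckerMap_apply,
    Fintype.sum_prod_type, Matrix.sum_apply, Matrix.smul_apply, smul_eq_mul, Finset.mul_sum,
    one_apply, ite_mul, one_mul, zero_mul, Finset.sum_ite_irrel,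
    Finset.sum_const_zero, Finset.sum_ite_eq, Finset.mem_univ, if_true]
  rw [Finset.sum_comm]
  refine Finset.sum_congr rfl fun u _ => ?_
  rw [Finset.sum_comm]
  exact Finset.sum_congr rfl fun v _ => Finset.sum_congr rfl fun z _ => mul_left_comm _ _ _

/-- The Kraus family with amplitudes `b` of a reference system attached. -/
def weightedKraus (b : ρ → ℂ) (E : α → Matrix p q ℂ) (u : ρ × α) : Matrix p q ℂ :=
  b u.1 • E u.2

theorem norm_stack_weightedKraus_le [Fintype q] [DecidableEq q] {E : α → Matrix p q ℂ}
    (hE : ∑ a, (E a)ᴴ * E a = 1) (b : ρ → ℂ) :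
    ‖stack (weightedKraus b E)‖ ≤ √(∑ r, ‖b r‖ ^ 2) := by
  classical
  have hgram : (stack (weightedKraus b E))ᴴ * stack (weightedKraus b E)
      = ((∑ r, ‖b r‖ ^ 2 : ℝ) : ℂ) • (1 : Matrix q q ℂ) := by
    rw [conjTranspose_stack_mul_stack, Fintype.sum_prod_type, ← hE, Complex.ofReal_sum,
      Finset.sum_smul]
    refine Finset.sum_congr rfl fun r _ => ?_
    rw [Finset.smul_sum]
    refine Finset.sum_congr rfl fun a _ => ?_
    rw [weightedKraus, conjTranspose_smul, Matrix.smul_mul, Matrix.mul_smul, smul_smul,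
      Complex.ofReal_pow, ← Complex.conj_mul', starRingEnd_apply]
  refine Real.le_sqrt_of_sq_le ?_
  rw [sq, ← l2_opNorm_conjTranspose_mul_self, hgram, norm_smul, Complex.norm_real,
    Real.norm_of_nonneg (by positivity)]
  exact mul_le_of_le_one_right (by positivity) l2_opNorm_one_le

variable [DecidableEq p]

/-- The operator whose deviation, summed over pairs of code states, is the correlation between the
reference and the environment seen by `S`. It lies in any algebra that contains the Kraus operators,
with norm bounded independently of their number. -/
def testOperator (E : α → Matrix p q ℂ) (S : Matrix (ρ × α) (ρ × α) ℂ) (b b' : ρ → ℂ) :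
    Matrix q q ℂ :=
  (stack (weightedKraus b E))ᴴ * (((1 : Matrix p p ℂ) ⊗ₖ Sᵀ) * stack (weightedKraus b' E))

theorem testOperator_eq_sum (E : α → Matrix p q ℂ) (S : Matrix (ρ × α) (ρ × α) ℂ)
    (b b' : ρ → ℂ) :
    testOperator E S b b' =
      ∑ u, ∑ v, (S v u * (b' v.1 * star (b u.1))) • ((E u.2)ᴴ * E v.2) := by
  rw [testOperator, conjTranspose_stack_mul_kronecker_mul_stack]
  simp only [weightedKraus, transpose_apply, conjTranspose_smul, Matrix.smul_mul, Matrix.mul_smul,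
    smul_smul]

theorem norm_testOperator_le [Fintype q] [DecidableEq q] [DecidableEq α] [DecidableEq ρ]
    {E : α → Matrix p q ℂ} (hE : ∑ a, (E a)ᴴ * E a = 1)
    {S : Matrix (ρ × α) (ρ × α) ℂ} (hS : Sᴴ * S = 1) (b b' : ρ → ℂ) :
    ‖testOperator E S b b'‖ ≤ √(∑ r, ‖b r‖ ^ 2) * √(∑ r, ‖b' r‖ ^ 2) := by
  have hunitary : ((1 : Matrix p p ℂ) ⊗ₖ Sᵀ)ᴴ * ((1 : Matrix p p ℂ) ⊗ₖ Sᵀ) = 1 := by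
    have hST : (Sᵀ)ᴴ * Sᵀ = 1 := by
      rw [conjTranspose_transpose_eq_transpose_conjTranspose, ← transpose_mul,
        mul_eq_one_comm.mp hS, transpose_one]
    rw [conjTranspose_kronecker, ← mul_kronecker_mul, conjTranspose_one, one_mul, hST,
      one_kronecker_one]
  calc ‖testOperator E S b b'‖
      ≤ ‖stack (weightedKraus b E)‖ * (1 * ‖stack (weightedKraus b' E)‖) := by
        refine (l2_opNorm_mul _ _).trans ?_
        rw [l2_opNorm_conjTranspose]
        refine mul_le_mul_of_nonneg_left ((l2_opNorm_mul _ _).trans ?_) (norm_nonneg _)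
        exact mul_le_mul_of_nonneg_right
          (l2_opNorm_le_one_of_conjTranspose_mul_self_eq_one hunitary) (norm_nonneg _)
    _ ≤ √(∑ r, ‖b r‖ ^ 2) * √(∑ r, ‖b' r‖ ^ 2) := by
        rw [one_mul]
        exact mul_le_mul (norm_stack_weightedKraus_le hE b) (norm_stack_weightedKraus_le hE b')
          (norm_nonneg _) (Real.sqrt_nonneg _)

end Stack

section Purification

variable {α ρ p q : Type*} [Fintype p] [Fintype q]

/-- The pure state left by the noise `E` on the joint state `Ψ` of code and reference, as a matrix
from reference and environment to the system; its Gram matrix is the state of reference and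
environment. -/
def purification (E : α → Matrix p q ℂ) (Ψ : Matrix q ρ ℂ) : Matrix p (ρ × α) ℂ :=
  of fun x u => (E u.2 * Ψ) x u.1

theorem conjTranspose_purification_mul_self_apply (E : α → Matrix p q ℂ) (Ψ : Matrix q ρ ℂ)
    (u v : ρ × α) :
    ((purification E Ψ)ᴴ * purification E Ψ) u v = (Ψᴴ * ((E u.2)ᴴ * E v.2) * Ψ) u.1 v.1 := by
  rw [Matrix.mul_assoc, Matrix.mul_assoc, ← Matrix.mul_assoc, ← conjTranspose_mul]
  rfl

theorem trace_conjTranspose_purification_mul_self [Fintype α] [Fintype ρ] [DecidableEq q]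
    {E : α → Matrix p q ℂ} (hE : ∑ a, (E a)ᴴ * E a = 1) (Ψ : Matrix q ρ ℂ) :
    ((purification E Ψ)ᴴ * purification E Ψ).trace = (Ψᴴ * Ψ).trace := by
  calc ((purification E Ψ)ᴴ * purification E Ψ).trace
      = ∑ r, (Ψᴴ * (∑ a, (E a)ᴴ * E a) * Ψ) r r := by
        simp only [trace, diag_apply, conjTranspose_purification_mul_self_apply,
          Fintype.sum_prod_type, Matrix.mul_sum, Matrix.sum_mul, Matrix.sum_apply]
    _ = (Ψᴴ * Ψ).trace := by rw [hE, Matrix.mul_one]; rfl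

end Purification

section Decoder

variable {α ρ q ι : Type*} [Fintype α] [Fintype ρ] [Fintype q]

theorem trace_conjTranspose_kronecker_mul {β : Type*} [Fintype β] (Ψ : Matrix q ρ ℂ)
    (T : Matrix β α ℂ) (Y : Matrix (q × β) (ρ × α) ℂ) :
    ((Ψ ⊗ₖ T)ᴴ * Y).trace =
      (Tᴴ * of fun b a => (Ψᴴ * Y.submatrix (·, b) (·, a)).trace).trace := by
  simp only [trace_conjTranspose_mul, of_apply, submatrix_apply, Fintype.sum_prod_type,
    kroneckerMap_apply, star_mul, Finset.mul_sum, mul_assoc]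
  rw [Finset.sum_comm]
  refine Finset.sum_congr rfl fun b _ => ?_
  simp_rw [Finset.sum_comm (s := (Finset.univ : Finset ρ)) (t := (Finset.univ : Finset α))]
  exact Finset.sum_comm

variable [DecidableEq q]

theorem exists_decoder_of_decoupled [DecidableEq α] [DecidableEq ρ]
    (hcard : Fintype.card ρ ≤ Fintype.card q) {E : α → Matrix q q ℂ}
    (hE : ∑ a, (E a)ᴴ * E a = 1) {Ψ : Matrix q ρ ℂ} (hΨ : (Ψᴴ * Ψ).trace = 1) {T : Matrix α α ℂ}
    (hT : (Tᴴ * T).trace = 1) {r : ℝ}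
    (hr : ∀ S : Matrix (ρ × α) (ρ × α) ℂ, Sᴴ * S = 1 →
      ‖(((purification E Ψ)ᴴ * purification E Ψ - (Ψᴴ * Ψ) ⊗ₖ (Tᴴ * T)) * S).trace‖ ≤ r) :
    ∃ D : α → Matrix q q ℂ, ∑ b, (D b)ᴴ * D b = 1 ∧
      1 - r ≤ ∑ b, ∑ a, ‖(Ψᴴ * (D b * (E a * Ψ))).trace‖ ^ 2 := by
  have hgram : (Ψ ⊗ₖ T)ᴴ * (Ψ ⊗ₖ T) = (Ψᴴ * Ψ) ⊗ₖ (Tᴴ * T) := by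
    rw [conjTranspose_kronecker, ← mul_kronecker_mul]
  obtain ⟨W, hW, hoverlap⟩ := exists_isometry_overlap_ge (A := purification E Ψ) (B := Ψ ⊗ₖ T)
    (card_le_of_conjTranspose_mul_self_eq_one ((conjTranspose_stack_mul_stack E).trans hE))
    (by simpa using Nat.mul_le_mul_right _ hcard)
    (by rw [trace_conjTranspose_purification_mul_self hE, hΨ])
    (by rw [hgram, trace_kronecker, hΨ, hT, one_mul]) (by rwa [hgram])
  let D (b : α) : Matrix q q ℂ := of fun x y => W (x, b) y
  have hD : stack D = W := rfl
  have hblock (b a : α) : (W * purification E Ψ).submatrix (·, b) (·, a) = D b * (E a * Ψ) := rfl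
  refine ⟨D, by rw [← conjTranspose_stack_mul_stack, hD, hW], ?_⟩
  set o := ((Ψ ⊗ₖ T)ᴴ * (W * purification E Ψ)).trace with ho
  have hnorm : ∑ b, ∑ a, ‖T b a‖ ^ 2 = 1 := by
    exact RCLike.ofReal_injective <|
      ((trace_conjTranspose_mul_self T).symm.trans hT).trans RCLike.ofReal_one.symm
  calc 1 - r ≤ ‖o‖ ^ 2 := by
        have := hoverlap.trans (Complex.re_le_norm o)
        linarith [two_mul_le_add_sq ‖o‖ 1]
    _ ≤ (∑ b, ∑ a, ‖T b a‖ ^ 2) * ∑ b, ∑ a, ‖(Ψᴴ * (D b * (E a * Ψ))).trace‖ ^ 2 := by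
        simp_rw [ho, trace_conjTranspose_kronecker_mul, ← hblock]
        exact norm_trace_conjTranspose_mul_sq_le _ _
    _ = ∑ b, ∑ a, ‖(Ψᴴ * (D b * (E a * Ψ))).trace‖ ^ 2 := by rw [hnorm, one_mul]

variable [Fintype ι] [DecidableEq ι]

theorem trace_purification_sub_kronecker_mul (V : Matrix q ι ℂ) (B : Matrix ι ρ ℂ)
    (E : α → Matrix q q ℂ) (i₀ : ι) (S : Matrix (ρ × α) (ρ × α) ℂ) {Λ : Matrix α α ℂ}
    (hV : Vᴴ * V = 1) (hΛ : ∀ a b, Λ a b = compression V ((E a)ᴴ * E b) i₀ i₀) :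
    (((purification E (V * B))ᴴ * purification E (V * B)
        - ((V * B)ᴴ * (V * B)) ⊗ₖ Λ) * S).trace =
      ∑ i, ∑ j, deviation i₀ (compression V (testOperator E S (B i) (B j))) i j := by
  have hgram : (V * B)ᴴ * (V * B) = Bᴴ * B :=
    conjTranspose_mul_mul_mul_cancel hV B B
  have hentry (u v : ρ × α) : ((purification E (V * B))ᴴ * purification E (V * B)
      - ((V * B)ᴴ * (V * B)) ⊗ₖ Λ) u v =
      (Bᴴ * deviation i₀ (compression V ((E u.2)ᴴ * E v.2)) * B) u.1 v.1 := by
    rw [Matrix.sub_apply, conjTranspose_purification_mul_self_apply, kroneckerMap_apply, hΛ, hgram,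
      deviation_apply, Matrix.mul_sub, Matrix.sub_mul, Matrix.mul_smul, Matrix.mul_one,
      Matrix.smul_mul, Matrix.sub_apply, Matrix.smul_apply, smul_eq_mul, mul_comm ((Bᴴ * B) _ _),
      compression_apply]
    simp only [conjTranspose_mul, Matrix.mul_assoc]
  simp only [trace, diag_apply, mul_apply (N := S), hentry, testOperator_eq_sum, map_sum, map_smul,
    Matrix.sum_apply, Matrix.smul_apply, smul_eq_mul]
  calc ∑ u, ∑ v, (Bᴴ * deviation i₀ (compression V ((E u.2)ᴴ * E v.2)) * B) u.1 v.1 * S v u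
      = ∑ u, ∑ v, ∑ i, ∑ j, S v u * (B j v.1 * star (B i u.1)) *
          deviation i₀ (compression V ((E u.2)ᴴ * E v.2)) i j := by
        refine Finset.sum_congr rfl fun u _ => Finset.sum_congr rfl fun v _ => ?_
        simp only [mul_apply, Finset.sum_mul, conjTranspose_apply]
        rw [Finset.sum_comm]
        refine Finset.sum_congr rfl fun i _ => Finset.sum_congr rfl fun j _ => ?_
        ring
    _ = ∑ i, ∑ j, ∑ u, ∑ v, S v u * (B j v.1 * star (B i u.1)) *
          deviation i₀ (compression V ((E u.2)ᴴ * E v.2)) i j := by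
        simp_rw [Finset.sum_comm (s := (Finset.univ : Finset (ρ × α)))
          (t := (Finset.univ : Finset ι))]

theorem norm_trace_purification_sub_kronecker_mul_le [DecidableEq α] [DecidableEq ρ]
    {𝒜 : StarSubalgebra ℂ (Matrix q q ℂ)} {V : Matrix q ι ℂ} (hV : Vᴴ * V = 1) {κ : ℝ} (hκ : 0 ≤ κ)
    (h : ∀ O ∈ 𝒜, ‖O‖ ≤ 1 → NearScalar κ (compression V O)) {E : α → Matrix q q ℂ}
    (hE : ∑ a, (E a)ᴴ * E a = 1) (hE𝒜 : ∀ a, E a ∈ 𝒜) {B : Matrix ι ρ ℂ}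
    (hB : (Bᴴ * B).trace = 1) (i₀ : ι) {Λ : Matrix α α ℂ}
    (hΛ : ∀ a b, Λ a b = compression V ((E a)ᴴ * E b) i₀ i₀) {S : Matrix (ρ × α) (ρ × α) ℂ}
    (hS : Sᴴ * S = 1) :
    ‖(((purification E (V * B))ᴴ * purification E (V * B)
        - ((V * B)ᴴ * (V * B)) ⊗ₖ Λ) * S).trace‖ ≤ 2 * κ * Fintype.card ι := by
  set β : ι → ℝ := fun i => √(∑ r, ‖B i r‖ ^ 2) with hβ
  have hβ_sq : ∑ i, β i ^ 2 = 1 := by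
    simp_rw [hβ, Real.sq_sqrt (Finset.sum_nonneg fun r _ => sq_nonneg ‖B _ r‖)]
    exact RCLike.ofReal_injective <|
      ((trace_conjTranspose_mul_self B).symm.trans hB).trans RCLike.ofReal_one.symm
  have hmem (i j : ι) : testOperator E S (B i) (B j) ∈ 𝒜 := by
    rw [testOperator_eq_sum]
    exact sum_mem fun u _ => sum_mem fun v _ =>
      𝒜.smul_mem (mul_mem (star_mem (hE𝒜 u.2)) (hE𝒜 v.2)) _
  have hterm (i j : ι) : ‖deviation i₀ (compression V (testOperator E S (B i) (B j))) i j‖ ≤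
      2 * κ * (β i * β j) :=
    (norm_deviation_compression_le (𝒜 := Subalgebra.toSubmodule 𝒜.toSubalgebra) h (hmem i j)
      i₀ i j).trans <|
      mul_le_mul_of_nonneg_left (norm_testOperator_le hE hS _ _) (by positivity)
  calc _ = ‖∑ i, ∑ j, deviation i₀ (compression V (testOperator E S (B i) (B j))) i j‖ := by
        rw [trace_purification_sub_kronecker_mul V B E i₀ S hV hΛ]
    _ ≤ ∑ i, ∑ j, 2 * κ * (β i * β j) :=
        norm_sum_le_of_le _ fun i _ => norm_sum_le_of_le _ fun j _ => hterm i j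
    _ = 2 * κ * (∑ i, β i) ^ 2 := by simp_rw [sq, Finset.sum_mul_sum, Finset.mul_sum]
    _ ≤ 2 * κ * (Fintype.card ι * ∑ i, β i ^ 2) := by
        gcongr
        simpa using sq_sum_le_card_mul_sum_sq (s := Finset.univ) (f := β)
    _ = 2 * κ * Fintype.card ι := by rw [hβ_sq, mul_one]

open scoped MatrixOrder ComplexOrder in
theorem exists_decoder_of_nearScalar [Nonempty ι] (hcard : Fintype.card ρ ≤ Fintype.card q)
    {𝒜 : StarSubalgebra ℂ (Matrix q q ℂ)} {V : Matrix q ι ℂ} (hV : Vᴴ * V = 1) {κ : ℝ} (hκ : 0 ≤ κ)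
    (h : ∀ O ∈ 𝒜, ‖O‖ ≤ 1 → NearScalar κ (compression V O)) {E : α → Matrix q q ℂ}
    (hE : ∑ a, (E a)ᴴ * E a = 1) (hE𝒜 : ∀ a, E a ∈ 𝒜) {B : Matrix ι ρ ℂ}
    (hB : (Bᴴ * B).trace = 1) :
    ∃ D : α → Matrix q q ℂ, ∑ b, (D b)ᴴ * D b = 1 ∧
      1 - 2 * κ * Fintype.card ι ≤ ∑ b, ∑ a, ‖((V * B)ᴴ * (D b * (E a * (V * B)))).trace‖ ^ 2 := by
  classical
  obtain ⟨i₀⟩ := ‹Nonempty ι›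
  let L : Matrix q α ℂ := of fun x a => (E a * V) x i₀
  let T := CFC.sqrt (Lᴴ * L)
  have hT : Tᴴ * T = Lᴴ * L := by
    rw [(CFC.sqrt_nonneg (Lᴴ * L)).posSemidef.1]
    exact CFC.sqrt_mul_sqrt_self _ (posSemidef_conjTranspose_mul_self L).nonneg
  have hL (a b : α) : (Lᴴ * L) a b = compression V ((E a)ᴴ * E b) i₀ i₀ := by
    rw [compression_apply, ← Matrix.mul_assoc, ← conjTranspose_mul, Matrix.mul_assoc]
    rfl
  have hL_trace : (Lᴴ * L).trace = 1 := by
    simp_rw [trace, diag_apply, hL, ← Matrix.sum_apply, ← map_sum, hE]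
    rw [compression_apply, Matrix.mul_one, hV, one_apply_eq]
  refine exists_decoder_of_decoupled hcard hE ?_ (hT ▸ hL_trace) fun S hS => ?_
  · rwa [conjTranspose_mul_mul_mul_cancel hV]
  · rw [hT]
    exact norm_trace_purification_sub_kronecker_mul_le hV hκ h hE hE𝒜 hB i₀ hL hS

end Decoder

section Code

theorem star_dotProduct_eq_trace {q R : Type*} [Fintype q] [Fintype R] (Φ Ψ : Matrix q R ℂ) :
    (star fun x : q × R => Φ x.1 x.2) ⬝ᵥ (fun x => Ψ x.1 x.2) = (Φᴴ * Ψ).trace := by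
  rw [trace_conjTranspose_mul, dotProduct, Fintype.sum_prod_type]
  rfl

theorem kronecker_one_mulVec {p q R : Type*} [Fintype q] [Fintype R] [DecidableEq R]
    (K : Matrix p q ℂ) (Ψ : Matrix q R ℂ) :
    (K ⊗ₖ (1 : Matrix R R ℂ)) *ᵥ (fun x => Ψ x.1 x.2) = fun x => (K * Ψ) x.1 x.2 := by
  ext ⟨x, r⟩
  simp [mulVec, dotProduct, Fintype.sum_prod_type, mul_apply, one_apply]

theorem re_star_dotProduct_conj_vecMulVec_mulVec {n : Type*} [Fintype n] (ψ : n → ℂ)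
    (M : Matrix n n ℂ) :
    (star ψ ⬝ᵥ ((M * vecMulVec ψ (star ψ) * Mᴴ) *ᵥ ψ)).re = ‖star ψ ⬝ᵥ (M *ᵥ ψ)‖ ^ 2 := by
  rw [mul_vecMulVec, vecMulVec_mul, ← star_mulVec, vecMulVec_mulVec, op_smul_eq_smul,
    dotProduct_smul, star_dotProduct, smul_eq_mul, ← starRingEnd_apply, Complex.conj_mul']
  exact_mod_cast rfl

variable {N k d : ℕ}

theorem recoveryFidelity_eq_sum {m n : ℕ} {R : Type} [Fintype R] [DecidableEq R]
    (E : Fin m → Op N) (D : Fin n → Op N) (Ψ : Matrix (Conf N) R ℂ) :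
    recoveryFidelity E D (fun x => Ψ x.1 x.2)
      = ∑ b, ∑ a, ‖(Ψᴴ * (D b * (E a * Ψ))).trace‖ ^ 2 := by
  have hkraus (ρ : Matrix (Conf N × R) (Conf N × R) ℂ) : applyKraus D (applyKraus E ρ) =
      ∑ b, ∑ a, ((D b ⊗ₖ 1) * (E a ⊗ₖ 1)) * ρ * ((D b ⊗ₖ 1) * (E a ⊗ₖ 1))ᴴ := by
    simp only [applyKraus, Finset.mul_sum, Finset.sum_mul, conjTranspose_mul, Matrix.mul_assoc]
  simp only [recoveryFidelity, hkraus, sum_mulVec, dotProduct_sum, Complex.re_sum,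
    re_star_dotProduct_conj_vecMulVec_mulVec]
  simp only [← mulVec_mulVec, kronecker_one_mulVec, star_dotProduct_eq_trace]

theorem linearIndependent_col_of_conjTranspose_mul_self_eq_one {𝕜 m n : Type*} [RCLike 𝕜]
    [Fintype m] [Finite n] [DecidableEq n] {U : Matrix m n 𝕜} (h : Uᴴ * U = 1) :
    LinearIndependent 𝕜 U.col := by
  cases nonempty_fintype n
  rw [← mulVec_injective_iff]
  refine Function.LeftInverse.injective (g := (Uᴴ *ᵥ ·)) fun x => ?_
  change Uᴴ *ᵥ (U *ᵥ x) = x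
  rw [mulVec_mulVec, h, one_mulVec]

theorem isAQECC_of_nearScalar {V : Matrix (Conf N) (Fin (2 ^ k)) ℂ} (hV : Vᴴ * V = 1) {κ ε : ℝ}
    (hκ : 0 ≤ κ) (h : ∀ a, ∀ O ∈ localAlgebra (window N a d), ‖O‖ ≤ 1 →
      NearScalar κ (compression V O)) (hε : 2 * κ * 2 ^ k ≤ ε) :
    IsAQECC k d ε (Submodule.span ℂ (Set.range V.col)) where
  finrank_eq := by
    rw [finrank_span_eq_card (linearIndependent_col_of_conjTranspose_mul_self_eq_one hV),
      Fintype.card_fin]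
  correctable a m E hE hloc ψ hψ hnorm := by
    simp_rw [← range_mulVecLin] at hψ
    choose b hb using hψ
    let B : Matrix (Fin (2 ^ k)) (Fin (2 ^ k)) ℂ := (of b)ᵀ
    obtain rfl : ψ = fun x => (V * B) x.1 x.2 := funext fun x => (congrFun (hb x.2) x.1).symm
    rw [star_dotProduct_eq_trace, conjTranspose_mul_mul_mul_cancel hV] at hnorm
    obtain ⟨D, hD, hfid⟩ := exists_decoder_of_nearScalar
      (card_le_of_conjTranspose_mul_self_eq_one hV) hV hκ (h a) hE
      (fun l => mem_localAlgebra.mpr (hloc l)) hnorm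
    refine ⟨m, D, hD, ?_⟩
    rw [recoveryFidelity_eq_sum]
    refine le_trans ?_ hfid
    push_cast [Fintype.card_fin]
    linarith

end Code

theorem IsAQECC.mono {N k d : ℕ} {ε ε' : ℝ} {C : Submodule ℂ (Ket N)} (h : IsAQECC k d ε C)
    (hε : ε ≤ ε') : IsAQECC k d ε' C where
  finrank_eq := h.finrank_eq
  correctable a m E hE hloc ψ hψ hnorm := by
    obtain ⟨n, D, hD, hfid⟩ := h.correctable a m E hE hloc ψ hψ hnorm
    exact ⟨n, D, hD, by linarith⟩

theorem natCast_add_one_le_four_mul_exp_log (N : ℕ) : (N : ℝ) + 1 ≤ 4 * Real.exp (Real.log N) := by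
  rcases Nat.eq_zero_or_pos N with rfl | h
  · norm_num
  · have hN : (1 : ℝ) ≤ N := by exact_mod_cast h
    rw [Real.exp_log (by positivity)]
    linarith

theorem sqrt_fluctuation_le (N k d : ℕ) {δ : ℝ} (hδ : 0 ≤ δ) :
    √((N + 1) * (4 ^ d * (4 * Fintype.card (Fin (2 ^ k)) ^ 2)) / δ) ≤
      4 * Real.exp (Real.log N / 2) * 2 ^ (d + k) / √δ := by
  rw [Real.sqrt_le_left (by positivity), div_pow, Real.sq_sqrt hδ]
  gcongr
  calc ((N : ℝ) + 1) * (4 ^ d * (4 * Fintype.card (Fin (2 ^ k)) ^ 2))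
      ≤ 4 * Real.exp (Real.log N) * (4 ^ d * (4 * Fintype.card (Fin (2 ^ k)) ^ 2)) := by
        gcongr
        exact natCast_add_one_le_four_mul_exp_log N
    _ = (4 * Real.exp (Real.log N / 2) * 2 ^ (d + k)) ^ 2 := by
        have hexp : Real.exp (Real.log N) = Real.exp (Real.log N / 2) ^ 2 := by
          rw [← Real.exp_nat_mul, Nat.cast_two, mul_div_cancel₀ _ two_ne_zero]
        have hpow : (4 : ℝ) ^ d = (2 ^ d) ^ 2 := by rw [pow_right_comm]; norm_num
        rw [hexp, hpow, Fintype.card_fin]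
        push_cast
        ring

theorem pi_div_two_mul_eq {β lam : ℝ} (h : lam = 2 * Real.pi / β) :
    Real.pi / (2 * lam) = β / 4 := by
  rw [h]
  field_simp
  ring

theorem IsShellFamily.abs_sub_le {N : ℕ} {ι : Type} [DecidableEq ι] {H : Op N} {E Δ : ℝ}
    {e : ι → ℝ} {ψ : ι → Ket N} (h : IsShellFamily H E Δ e ψ) (i j : ι) :
    |e i - e j| ≤ 2 * Δ :=
  (Real.dist_le_of_mem_Icc (h.mem_shell i) (h.mem_shell j)).trans_eq (by ring)

section Probability

open MeasureTheory
open scoped ComplexStarModule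

theorem window_min_eq (N a d : ℕ) : window N (min a N) d = window N a d := by
  ext i
  have := i.2
  simp only [window, Finset.mem_filter, Finset.mem_univ, true_and]
  omega

theorem card_window_le (N a d : ℕ) : (window N a d).card ≤ d := by
  have hsub : (window N a d).map Fin.valEmbedding ⊆ Finset.Ico a (a + d) := by
    intro i hi
    obtain ⟨j, hj, rfl⟩ := Finset.mem_map.mp hi
    exact Finset.mem_Ico.mpr (Finset.mem_filter.mp hj).2
  simpa using Finset.card_le_card hsub

theorem card_prod_addChar_le_four_pow {N d : ℕ} {W : Finset (Fin N)} (hW : W.card ≤ d) :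
    Fintype.card ((W → Fin 2) × AddChar (W → Fin 2) ℂ) ≤ 4 ^ d := by
  rw [Fintype.card_prod, AddChar.card_eq, Fintype.card_fun, Fintype.card_fin, Fintype.card_coe,
    ← mul_pow]
  exact Nat.pow_le_pow_right (by norm_num) hW

/-- The operators of norm at most one that act on at most `d` consecutive qubits; unlike local
observables they need not be Hermitian. -/
def localContractions (N d : ℕ) : Set (Op N) :=
  ⋃ a, {O | O ∈ localAlgebra (window N a d) ∧ ‖O‖ ≤ 1}

theorem localContractions_eq_iUnion_fin (N d : ℕ) :
    localContractions N d =
      ⋃ a : Fin (N + 1), {O | O ∈ localAlgebra (window N a d) ∧ ‖O‖ ≤ 1} := by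
  refine (Set.iUnion_subset fun a => ?_).antisymm (Set.iUnion_subset fun a => ?_)
  · rw [← window_min_eq]
    exact Set.subset_iUnion (fun a : Fin (N + 1) => {O | O ∈ localAlgebra (window N a d) ∧ ‖O‖ ≤ 1})
      ⟨min a N, by omega⟩
  · exact Set.subset_iUnion (fun a : ℕ => {O | O ∈ localAlgebra (window N a d) ∧ ‖O‖ ≤ 1}) a

variable {N d : ℕ} {Ω ι κ : Type*} [MeasurableSpace Ω] {μ : Measure Ω} [DecidableEq ι]
  {σ : Ω → ℝ} {m : ℝ} {ψ : Ω → ι → Ket N} {𝒜 ℬ : Set (Op N)}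

/-- The matrices of the operators of `𝒜` in the states `ψ` are jointly near scalar, with error
`σ √Z` for a nonnegative random variable `Z` of mean at most `m`. Since `Z` does not depend on the
operator, a single application of Markov's inequality controls all of `𝒜`. -/
def FluctuatesWithin (μ : Measure Ω) (σ : Ω → ℝ) (m : ℝ) (ψ : Ω → ι → Ket N) (𝒜 : Set (Op N)) :
    Prop :=
  ∃ Z : Ω → ℝ, Integrable Z μ ∧ (∀ x, 0 ≤ Z x) ∧ ∫ x, Z x ∂μ ≤ m ∧
    ∀ᵐ x ∂μ, ∀ A ∈ 𝒜, NearScalar (σ x * √(Z x)) (compression (of (ψ x))ᵀ A)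

theorem FluctuatesWithin.mono (h : FluctuatesWithin μ σ m ψ 𝒜) {m' : ℝ} (hm : m ≤ m')
    (hℬ : ℬ ⊆ 𝒜) : FluctuatesWithin μ σ m' ψ ℬ := by
  obtain ⟨Z, hint, hpos, hmean, hZ⟩ := h
  refine ⟨Z, hint, hpos, hmean.trans hm, ?_⟩
  filter_upwards [hZ] with x hx A hA using hx A (hℬ hA)

theorem FluctuatesWithin.iUnion [Fintype κ] (hσ : ∀ x, 0 ≤ σ x) {m : κ → ℝ}
    {𝒜 : κ → Set (Op N)} (h : ∀ w, FluctuatesWithin μ σ (m w) ψ (𝒜 w)) :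
    FluctuatesWithin μ σ (∑ w, m w) ψ (⋃ w, 𝒜 w) := by
  choose Z hint hpos hmean hZ using h
  refine ⟨fun x => ∑ w, Z w x, integrable_finsetSum _ fun w _ => hint w,
    fun x => Finset.sum_nonneg fun w _ => hpos w x, ?_, ?_⟩
  · rw [integral_finsetSum _ fun w _ => hint w]
    exact Finset.sum_le_sum fun w _ => hmean w
  · filter_upwards [ae_all_iff.mpr hZ] with x hx A hA
    obtain ⟨w, hA⟩ := Set.mem_iUnion.mp hA
    refine (hx w A hA).mono (mul_le_mul_of_nonneg_left (Real.sqrt_le_sqrt ?_) (hσ x))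
    exact Finset.single_le_sum (f := fun w => Z w x) (fun w _ => hpos w x) (Finset.mem_univ w)

theorem FluctuatesWithin.sum_smul [Fintype κ] (hσ : ∀ x, 0 ≤ σ x) {b : ℝ} (hb : 0 ≤ b)
    {m : κ → ℝ} {A : κ → Op N} (h : ∀ w, FluctuatesWithin μ σ (m w) ψ {A w}) :
    FluctuatesWithin μ σ (b * ∑ w, m w) ψ
      {O | ∃ o : κ → ℂ, O = ∑ w, o w • A w ∧ ∑ w, ‖o w‖ ^ 2 ≤ b} := by
  choose Z hint hpos hmean hZ using h
  refine ⟨fun x => b * ∑ w, Z w x, (integrable_finsetSum _ fun w _ => hint w).const_mul b,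
    fun x => mul_nonneg hb (Finset.sum_nonneg fun w _ => hpos w x), ?_, ?_⟩
  · rw [integral_const_mul, integral_finsetSum _ fun w _ => hint w]
    exact mul_le_mul_of_nonneg_left (Finset.sum_le_sum fun w _ => hmean w) hb
  · filter_upwards [ae_all_iff.mpr hZ] with x hx O ⟨o, hO, ho⟩
    rw [hO, map_sum]
    simp_rw [map_smul]
    exact NearScalar.sum_smul (hσ x) (fun w => hpos w x) ho fun w => hx w _ rfl

theorem SatisfiesETH.fluctuatesWithin [Fintype ι] {β c E : ℝ} {S : Ω → ℝ} {e : Ω → ι → ℝ}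
    {A : Op N} (hβ : 0 ≤ β) (h : SatisfiesETH μ β c E S e ψ A) :
    FluctuatesWithin μ (fun x => c * Real.exp (-S x / 2)) (Fintype.card ι ^ 2) ψ {A} := by
  obtain ⟨avg, f, R, -, -, hf, hR, hae⟩ := h
  have hint (i j) : Integrable (fun x => ‖R i j x‖ ^ 2) μ :=
    (memLp_two_iff_integrable_sq_norm (hR i j).1.1).mp (hR i j).1
  have hc : 0 ≤ c := by simpa using (abs_nonneg _).trans (hf 0)
  have hf_le (ω : ℝ) : |f E ω| ≤ c := by
    refine (hf ω).trans (mul_le_of_le_one_right hc (Real.exp_le_one_iff.mpr ?_))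
    rw [neg_mul, neg_nonpos]
    positivity
  refine ⟨fun x => ∑ i, ∑ j, ‖R i j x‖ ^ 2,
    integrable_finsetSum _ fun i _ => integrable_finsetSum _ fun j _ => hint i j,
    fun x => by positivity, le_of_eq ?_, ?_⟩
  · rw [integral_finsetSum _ fun i _ => integrable_finsetSum _ fun j _ => hint i j]
    simp_rw [integral_finsetSum _ fun j _ => hint _ j, (hR _ _).2.2]
    simp [sq]
  · filter_upwards [hae] with x hx A' hA'
    obtain rfl : A' = A := hA'
    refine ⟨avg E, fun i j => ?_⟩
    have hentry : (compression (of (ψ x))ᵀ A' - (avg E : ℂ) • 1) i j =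
        ((Real.exp (-S x / 2) * f E (e x i - e x j) : ℝ) : ℂ) * R i j x := by
      have hcomp : compression (of (ψ x))ᵀ A' i j = star (ψ x i) ⬝ᵥ (A' *ᵥ ψ x j) := by
        rw [compression_apply, Matrix.mul_assoc]
        rfl
      rw [Matrix.sub_apply, hcomp, hx i j, Matrix.smul_apply, one_apply, smul_eq_mul, mul_ite,
        mul_one, mul_zero, add_sub_cancel_left]
    have hR_le : ‖R i j x‖ ≤ √(∑ i, ∑ j, ‖R i j x‖ ^ 2) := by
      refine Real.le_sqrt_of_sq_le ?_
      rw [← Fintype.sum_prod_type']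
      exact Finset.single_le_sum (f := fun p : ι × ι => ‖R p.1 p.2 x‖ ^ 2)
        (fun _ _ => by positivity) (Finset.mem_univ (i, j))
    rw [hentry, norm_mul, Complex.norm_real, Real.norm_eq_abs, abs_mul, Real.abs_exp, mul_comm c]
    gcongr
    exact hf_le _

theorem fluctuatesWithin_singleton_of_norm_le_one (hσ : ∀ x, 0 ≤ σ x)
    (h : ∀ A, IsLocalObservable d A → FluctuatesWithin μ σ m ψ {A}) {a : ℕ} {O : Op N}
    (hO : O ∈ localAlgebra (window N a d)) (hO1 : ‖O‖ ≤ 1) :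
    FluctuatesWithin μ σ (4 * m) ψ {O} := by
  have hℜ : IsLocalObservable d (ℜ O : Op N) := by
    refine ⟨(ℜ O).2, ⟨a, mem_localAlgebra.mp ?_⟩, (realPart.norm_le O).trans hO1⟩
    rw [realPart_apply_coe, ← Complex.coe_smul]
    exact SMulMemClass.smul_mem _ (add_mem hO (star_mem hO))
  have hℑ : IsLocalObservable d (ℑ O : Op N) := by
    refine ⟨(ℑ O).2, ⟨a, mem_localAlgebra.mp ?_⟩, (imaginaryPart.norm_le O).trans hO1⟩
    rw [imaginaryPart_apply_coe, ← Complex.coe_smul]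
    exact SMulMemClass.smul_mem _ (SMulMemClass.smul_mem _ (sub_mem hO (star_mem hO)))
  refine (FluctuatesWithin.sum_smul hσ zero_le_two (A := ![(ℜ O : Op N), (ℑ O : Op N)])
    (m := fun _ => m) ?_).mono ?_ ?_
  · exact Fin.forall_fin_two.mpr ⟨h _ hℜ, h _ hℑ⟩
  · rw [Fin.sum_univ_two]
    linarith
  · intro O' hO'
    refine ⟨![1, Complex.I], hO'.trans ?_, by norm_num [Fin.sum_univ_two]⟩
    simpa [Fin.sum_univ_two] using (realPart_add_I_smul_imaginaryPart O).symm

theorem fluctuatesWithin_localContractions (hσ : ∀ x, 0 ≤ σ x) (hm : 0 ≤ m)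
    (h : ∀ A, IsLocalObservable d A → FluctuatesWithin μ σ m ψ {A}) :
    FluctuatesWithin μ σ ((N + 1) * (4 ^ d * (4 * m))) ψ (localContractions N d) := by
  have hwindow (a : ℕ) : FluctuatesWithin μ σ (4 ^ d * (4 * m)) ψ
      {O | O ∈ localAlgebra (window N a d) ∧ ‖O‖ ≤ 1} := by
    have hweyl (w) : FluctuatesWithin μ σ (4 * m) ψ {embed (window N a d) (weyl w)} :=
      fluctuatesWithin_singleton_of_norm_le_one hσ h ⟨weyl w, rfl⟩ (norm_embed_weyl_le_one w)
    refine (FluctuatesWithin.sum_smul hσ zero_le_one hweyl).mono ?_ fun O hO => ?_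
    · rw [one_mul, Finset.sum_const, nsmul_eq_mul, Finset.card_univ]
      gcongr
      exact_mod_cast card_prod_addChar_le_four_pow (card_window_le N a d)
    · obtain ⟨o, hsum, ho⟩ := exists_eq_sum_smul_embed_weyl hO.1
      exact ⟨o, hsum, ho.trans (pow_le_one₀ (norm_nonneg O) hO.2)⟩
  rw [localContractions_eq_iUnion_fin]
  refine (FluctuatesWithin.iUnion hσ fun a : Fin (N + 1) => hwindow a).mono (le_of_eq ?_) le_rfl
  simp

theorem measure_ge_div_le_ofReal {Z : Ω → ℝ} (hint : Integrable Z μ) (hpos : ∀ x, 0 ≤ Z x)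
    {δ : ℝ} (hm : 0 < m) (hδ : 0 < δ) (hmean : ∫ x, Z x ∂μ ≤ m) :
    μ {x | m / δ ≤ Z x} ≤ ENNReal.ofReal δ := by
  have hmarkov := mul_meas_ge_le_integral_of_nonneg (Filter.Eventually.of_forall hpos) hint (m / δ)
  rw [← ofReal_measureReal (hint.measure_ge_lt_top (by positivity)).ne]
  refine ENNReal.ofReal_le_ofReal (le_of_mul_le_mul_left (hmarkov.trans (hmean.trans ?_))
    (show 0 < m / δ by positivity))
  rw [div_mul_cancel₀ _ hδ.ne']

theorem measure_not_isAQECC_le {k : ℕ} {ψ : Ω → Fin (2 ^ k) → Ket N} (hσ : ∀ x, 0 ≤ σ x)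
    (hm : 0 < m) (horth : ∀ᵐ x ∂μ, ∀ i j, star (ψ x i) ⬝ᵥ ψ x j = if i = j then 1 else 0)
    (h : FluctuatesWithin μ σ m ψ (localContractions N d)) {δ : ℝ} (hδ : 0 < δ) :
    μ {x | ¬ IsAQECC k d (2 * (σ x * √(m / δ)) * 2 ^ k) (Submodule.span ℂ (Set.range (ψ x)))} ≤
      ENNReal.ofReal δ := by
  obtain ⟨Z, hint, hpos, hmean, hZ⟩ := h
  refine (measure_mono_ae ?_).trans (measure_ge_div_le_ofReal hint hpos hm hδ hmean)
  filter_upwards [horth, hZ] with x hx hZx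
  refine fun hbad => not_lt.mp fun hlt => hbad ?_
  have hV : ((of (ψ x))ᵀ)ᴴ * (of (ψ x))ᵀ = 1 := by
    ext i j
    rw [one_apply, ← hx i j]
    rfl
  refine isAQECC_of_nearScalar hV (mul_nonneg (hσ x) (Real.sqrt_nonneg _))
    (fun a O hO hO1 => ?_) le_rfl
  have hO' : O ∈ localContractions N d := Set.mem_iUnion.mpr ⟨a, hO, hO1⟩
  refine (hZx O hO').mono (mul_le_mul_of_nonneg_left (Real.sqrt_le_sqrt ?_) (hσ x))
  exact hlt.le

end Probability

end ETHCode

end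

open MeasureTheory in
theorem theorem1_general {N k d : ℕ} {Ω : Type*} [MeasurableSpace Ω] {μ : Measure Ω} {β c E : ℝ}
    (hβ : 0 ≤ β) (hc : 0 ≤ c) {S : Ω → ℝ} {e : Ω → Fin (2 ^ k) → ℝ}
    {ψ : Ω → Fin (2 ^ k) → ETHCode.Ket N}
    (horth : ∀ᵐ x ∂μ, ∀ i j, star (ψ x i) ⬝ᵥ ψ x j = if i = j then 1 else 0)
    (hS : ∀ᵐ x ∂μ, ∀ i j, β * |e x i - e x j| + 2 * Real.log N ≤ S x)
    (hETH : ∀ A : ETHCode.Op N, ETHCode.IsLocalObservable d A →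
      ETHCode.SatisfiesETH μ β c E S e ψ A)
    {δ : ℝ} (hδ : 0 < δ) :
    μ {x | ¬ ∀ i j, ETHCode.IsAQECC k d
        (8 * c / √δ * (2 ^ (d + 2 * k) * Real.exp (-S x / 4 - β / 4 * |e x i - e x j|)))
        (Submodule.span ℂ (Set.range (ψ x)))} ≤ ENNReal.ofReal δ := by
  have hσ (x : Ω) : 0 ≤ c * Real.exp (-S x / 2) := by positivity
  have hfluct := ETHCode.fluctuatesWithin_localContractions hσ (by positivity) fun A hA =>
    (hETH A hA).fluctuatesWithin hβ
  refine le_trans (measure_mono_ae ?_)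
    (ETHCode.measure_not_isAQECC_le hσ (by rw [Fintype.card_fin]; positivity) horth hfluct hδ)
  filter_upwards [hS] with x hSx
  refine mt fun hcode i j => hcode.mono ?_
  have hexp : Real.exp (-S x / 2) * Real.exp (Real.log N / 2) ≤
      Real.exp (-S x / 4 - β / 4 * |e x i - e x j|) := by
    rw [← Real.exp_add, Real.exp_le_exp]
    linarith [hSx i j]
  calc _ ≤ 2 * (c * Real.exp (-S x / 2) *
          (4 * Real.exp (Real.log N / 2) * 2 ^ (d + k) / √δ)) * 2 ^ k := by
        gcongr
        exact ETHCode.sqrt_fluctuation_le N k d hδ.le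
    _ = 8 * c / √δ * (2 ^ (d + 2 * k) *
          (Real.exp (-S x / 2) * Real.exp (Real.log N / 2))) := by ring
    _ ≤ _ := by gcongr

theorem theorem1 (c : ℝ) (hc : 0 < c) :
    ∃ K : ℝ, 0 < K ∧
      ∀ (N k d : ℕ) (Ω : Type*) [MeasurableSpace Ω] (μ : MeasureTheory.Measure Ω)
        [MeasureTheory.IsProbabilityMeasure μ]
        -- the Hamiltonian, and the energies and eigenstates that span the code
        (H : Ω → ETHCode.Op N) (e : Ω → Fin (2 ^ k) → ℝ) (ψ : Ω → Fin (2 ^ k) → ETHCode.Ket N)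
        -- energy and half-width of the shell, inverse temperature, growth rate
        (E Δ β lam : ℝ)
        -- the observable, time scales and tolerances that define the growth rate
        (A₀ : ETHCode.Op N) (td ts M η : ℝ),
        0 < β →
        (∀ x, (H x).IsHermitian) →
        (∀ᵐ x ∂μ, ETHCode.IsShellFamily (H x) E Δ (e x) (ψ x)) →
        -- the width of the shell is intensive, its entropy is extensive
        (∀ᵐ x ∂μ, β * (2 * Δ) + 2 * Real.log N ≤ ETHCode.microEntropy (H x) E Δ) →
        (∀ A : ETHCode.Op N, ETHCode.IsLocalObservable d A →
          ETHCode.SatisfiesETH μ β c E (fun x => ETHCode.microEntropy (H x) E Δ) e ψ A) →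
        ETHCode.IsLocalObservable d A₀ →
        (∀ᵐ x ∂μ, ETHCode.HasGrowthRate (H x) A₀ β lam td ts M η) →
        lam = 2 * Real.pi / β →
        ∀ δ : ℝ, 0 < δ → δ < 1 →
          μ {x | ¬ ∀ i j, ETHCode.IsAQECC k d
              (K / Real.sqrt δ * (2 ^ (d + 2 * k) *
                Real.exp (-(ETHCode.microEntropy (H x) E Δ) / 4
                  - Real.pi / (2 * lam) * |e x i - e x j|)))
              (Submodule.span ℂ (Set.range (ψ x)))} ≤ ENNReal.ofReal δ := by
  refine ⟨8 * c, by positivity, fun N k d Ω _ μ _ H e ψ E Δ β lam A₀ td ts M η hβ _ hshell hS hETH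
    _ _ hlam δ hδ _ => ?_⟩
  rw [ETHCode.pi_div_two_mul_eq hlam]
  refine theorem1_general hβ.le hc.le (hshell.mono fun x hx => hx.orthonormal) ?_ hETH hδ
  filter_upwards [hshell, hS] with x hx hSx i j
  linarith [mul_le_mul_of_nonneg_left (hx.abs_sub_le i j) hβ.le]
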